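/- A \emph{transfinite word} on a set $X$ is a map $w$ from an ordinal $|w|$, its \emph{length}, to $X$; words are concatenated in the usual way, and $AB=\{ww' \mid w\in A,\ w'\in B\}$ for sets of words $A,B$. For $F\subseteq X$ and an ordinal $\alpha$, $F^{<\alpha}$ is the set of transfinite words of length $<\alpha$ all of whose letters are in $F$. If $X$ is a topological space and $Y$ is a set of transfinite words on $X$, the \emph{regular subword topology} on $Y$ is the coarsest topology in which all the sets $(F_1^{<\alpha_1}F_2^{<\alpha_2}\cdots F_n^{<\alpha_n})\cap Y$ are closed, where $n\in\mathbb N$, $F_1,\dots,F_n$ are closed subsets of $X$ and $\alpha_1,\dots,\alpha_n$ are ordinals (the empty product, $n=0$, is $\{\epsilon\}$, where $\epsilon$ is the empty word). A \emph{bound} is an ordinal of the form $\omega^\beta$ or $\omega^\beta+1$, $\beta\ge 0$; an ordinal is \emph{decomposable} if it is not of the form $\omega^\beta$. An \emph{atom} is an expression $F^{<\gamma}$ where $F\subseteq X$ is closed, $\gamma\ne\omega^0$ is a bound, and $F$ is irreducible if $\gamma=\omega^0+1$. For a bound $\alpha$, an \emph{$\alpha$-product} is a set of words of the form $F_1^{<\gamma_1}F_2^{<\gamma_2}\cdots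 F_n^{<\gamma_n}$, $n\in\mathbb N$, where each $F_i^{<\gamma_i}$ is an atom with $F_i\neq\emptyset$ and $\gamma_i\le\alpha$ and where, if $\alpha$ is decomposable, $\gamma_i<\alpha$ for every $i$ with $1\le i<n$. \textbf{Theorem.} Let $X$ be a Noetherian space (a topological space in which every open subset is compact). Then every set $Y$ of transfinite words on $X$ is Noetherian in the regular subword topology. Moreover, for every bound $\alpha$, the irreducible closed subsets of $X^{<\alpha}$, with the regular subword topology, are exactly the $\alpha$-products. -/

import Mathlib

universe u v

/-- A transfinite word on `X`: a map from an ordinal, its length, to `X`.  The ordinal `length` is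
seen as the set of the ordinals strictly below it. -/
@[ext]
structure TransfiniteWord (X : Type u) where
  length : Ordinal.{v}
  letter : Set.Iio length → X

namespace TransfiniteWord

variable {X : Type u}

/-- The empty word. -/
def empty : TransfiniteWord.{u, v} X where
  length := 0
  letter β := absurd (Set.mem_Iio.mp β.2) (not_lt_of_ge zero_le)

/-- Concatenation: the word of length `|w| + |w'|` whose letter at position `β < |w|` is that of `w`,
and whose letter at position `|w| + β`, with `β < |w'|`, is the letter of `w'` at position `β`. -/
noncomputable def append (w w' : TransfiniteWord.{u, v} X) : TransfiniteWord.{u, v} X where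
  length := w.length + w'.length
  letter β :=
    if h : (β : Ordinal.{v}) < w.length then w.letter ⟨β, h⟩
    else w'.letter ⟨β - w.length, (Ordinal.sub_lt_of_le (not_lt.mp h)).mpr β.2⟩

/-- The set of words `X^{<α}`. -/
def below (X : Type u) (α : Ordinal.{v}) : Set (TransfiniteWord.{u, v} X) :=
  {w | w.length < α}

/-- The set `F^{<α}` of the words of length `< α` all of whose letters are in `F`. -/
def power (F : Set X) (α : Ordinal.{v}) : Set (TransfiniteWord.{u, v} X) :=
  {w | w.length < α ∧ ∀ β, w.letter β ∈ F}

/-- The concatenation `A B = {w w' | w ∈ A, w' ∈ B}` of two sets of words. -/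
def concat (A B : Set (TransfiniteWord.{u, v} X)) : Set (TransfiniteWord.{u, v} X) :=
  Set.image2 append A B

/-- `F₁^{<α₁} F₂^{<α₂} ⋯ Fₙ^{<αₙ}` for the list `(F₁, α₁), …, (Fₙ, αₙ)`; for `n = 0` this is the
set whose only element is the empty word. -/
def product (L : List (Set X × Ordinal.{v})) : Set (TransfiniteWord.{u, v} X) :=
  L.foldr (fun A P => concat (power A.1 A.2) P) {empty}

/-- The regular subword topology on a set `Y` of transfinite words on `X`: the coarsest topology in
which the sets `(F₁^{<α₁} ⋯ Fₙ^{<αₙ}) ∩ Y` are closed, where `n` is a natural number, the `Fᵢ` are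
closed in `X` and the `αᵢ` are ordinals. -/
instance regularSubwordTopology [TopologicalSpace X] (Y : Set (TransfiniteWord.{u, v} X)) :
    TopologicalSpace Y :=
  TopologicalSpace.generateFrom
    {U | ∃ L : List (Set X × Ordinal.{v}), (∀ A ∈ L, IsClosed A.1) ∧
      U = ((Subtype.val : Y → TransfiniteWord.{u, v} X) ⁻¹' product L)ᶜ}

/-- An ordinal of the form `ω^β`. -/
def IsIndecomposable (γ : Ordinal.{v}) : Prop :=
  ∃ β : Ordinal.{v}, γ = Ordinal.omega0 ^ β

/-- A bound: an ordinal of the form `ω^β` or `ω^β + 1`. -/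
def IsBound (γ : Ordinal.{v}) : Prop :=
  ∃ β : Ordinal.{v}, γ = Ordinal.omega0 ^ β ∨ γ = Ordinal.omega0 ^ β + 1

/-- The expression `F^{<γ}`, given by the pair `(F, γ)`, is an atom: `F` is closed, `γ` is a bound
other than `ω^0`, and `F` is irreducible if `γ = ω^0 + 1`. -/
structure IsAtomExpr [TopologicalSpace X] (A : Set X × Ordinal.{v}) : Prop where
  isClosed : IsClosed A.1
  isBound : IsBound A.2
  nontrivial : A.2 ≠ Ordinal.omega0 ^ (0 : Ordinal.{v})
  isIrreducible : A.2 = Ordinal.omega0 ^ (0 : Ordinal.{v}) + 1 → IsIrreducible A.1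

/-- An `α`-product: a set `F₁^{<γ₁} ⋯ Fₙ^{<γₙ}` of words, where every `Fᵢ^{<γᵢ}` is an atom with
`Fᵢ` non-empty and `γᵢ ≤ α` and where, if `α` is decomposable, `γᵢ < α` for all `i < n`. -/
def IsAlphaProduct [TopologicalSpace X] (α : Ordinal.{v})
    (P : Set (TransfiniteWord.{u, v} X)) : Prop :=
  ∃ L : List (Set X × Ordinal.{v}),
    (∀ A ∈ L, IsAtomExpr A ∧ A.1.Nonempty ∧ A.2 ≤ α) ∧
    (¬ IsIndecomposable α → ∀ A ∈ L.dropLast, A.2 < α) ∧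
    P = product L

end TransfiniteWord

/-! All sets `Y` carry the topology induced from a single space of words, so the work takes place
there. Two facts drive the proof. Concatenation is continuous (`continuous_append`): the preimage of
a product under it is a finite union of rectangles of products. And open sets are upward closed for
the subword relation (`IsOpen.mem_of_subword`).

Both claims use well-founded induction on the pair `(F, γ)` (`power_inter_product_induction`). If
F^{<γ} is not contained in a nonempty product of powers F_i^{<α_i}, their intersection lies in the
product of the (F ∩ F_i)^{<min(γ, α_i)}, and every one of these pairs is strictly smaller than `(F,
γ)`. So it suffices that the property in question survives concatenation.

Noetherianity survives, since a concatenation is a continuous image of a product of Noetherian sets;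
Alexander's subbasis theorem then reduces F^{<γ} to its proper subbasic closed subsets.

For irreducible closed sets, `HasAtomProducts.concat` lifts C ⊆ AB to an irreducible component of
its preimage in A × B, which is itself a rectangle. If γ is not a bound, F^{<γ} is covered by a
concatenation of smaller powers; if it is one, C is all of F^{<γ} or lies in a smaller product.
Conversely atoms are irreducible: except for γ = 2, two words of F^{<γ} always have a common
superword there. Comparing lengths of words then gives the constraints defining α-products. -/

open Ordinal TopologicalSpace Set

namespace TransfiniteWord

/-! ### Words, subwords and products of powers. -/

section Words

variable {X : Type u} {u v w a b c : TransfiniteWord.{u, v} X}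

/-- The letter of `w` at an arbitrary position, `none` beyond the length of `w`. -/
noncomputable def get (w : TransfiniteWord.{u, v} X) (β : Ordinal.{v}) : Option X :=
  if h : β < w.length then some (w.letter ⟨β, h⟩) else none

theorem get_of_lt {β : Ordinal.{v}} (h : β < w.length) : w.get β = some (w.letter ⟨β, h⟩) :=
  dif_pos h

theorem get_of_le {β : Ordinal.{v}} (h : w.length ≤ β) : w.get β = none :=
  dif_neg h.not_gt

theorem get_eq_none_iff {β : Ordinal.{v}} : w.get β = none ↔ w.length ≤ β := by
  refine ⟨fun h => ?_, get_of_le⟩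
  by_contra h'
  simp [get_of_lt (not_le.mp h')] at h

/-- The value `none` marks exactly the positions beyond the end, so `get` also determines the
length; this avoids comparing letter maps with different domains. -/
theorem ext_get (h : ∀ β, a.get β = b.get β) : a = b := by
  have hl : a.length = b.length := by
    refine eq_of_forall_ge_iff fun c => ?_
    rw [← get_eq_none_iff, h, get_eq_none_iff]
  obtain ⟨l, f⟩ := a
  obtain ⟨l', f'⟩ := b
  obtain rfl : l = l' := hl
  congr 1
  funext β
  have := h β
  rw [get_of_lt (w := ⟨l, f⟩) β.2, get_of_lt (w := ⟨l, f'⟩) β.2] at this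
  exact Option.some_injective _ this

theorem mem_power_iff {F : Set X} {α : Ordinal.{v}} :
    w ∈ power F α ↔ w.length < α ∧ ∀ β x, w.get β = some x → x ∈ F := by
  refine and_congr_right fun _ => ⟨fun h β x hx => ?_, fun h β => h β _ (get_of_lt β.2)⟩
  by_cases hβ : β < w.length
  · rw [get_of_lt hβ] at hx
    exact Option.some_injective _ hx ▸ h _
  · simp [get_of_le (not_lt.mp hβ)] at hx

theorem power_mono {F G : Set X} {α β : Ordinal.{v}} (h : F ⊆ G) (h' : α ≤ β) :
    power F α ⊆ power G β :=
  fun _ hw => ⟨hw.1.trans_le h', fun p => h (hw.2 p)⟩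

@[simp]
theorem get_empty (β : Ordinal.{v}) : (empty : TransfiniteWord.{u, v} X).get β = none :=
  get_of_le zero_le

theorem get_append (β : Ordinal.{v}) :
    (append a b).get β = if β < a.length then a.get β else b.get (β - a.length) := by
  split_ifs with h
  · rw [get_of_lt h, get_of_lt (h.trans_le le_self_add : β < (append a b).length)]
    simp [append, h]
  · by_cases h' : β < a.length + b.length
    · rw [get_of_lt (h' : β < (append a b).length),
        get_of_lt ((Ordinal.sub_lt_of_le (not_lt.mp h)).mpr h')]
      simp [append, h]
    · rw [get_of_le (not_lt.mp h' : (append a b).length ≤ β), get_of_le]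
      exact (Ordinal.le_sub_of_le (not_lt.mp h)).mpr (not_lt.mp h')

theorem get_append_of_lt {β : Ordinal.{v}} (h : β < a.length) : (append a b).get β = a.get β := by
  rw [get_append, if_pos h]

@[simp]
theorem get_append_add (β : Ordinal.{v}) : (append a b).get (a.length + β) = b.get β := by
  rw [get_append, if_neg le_self_add.not_gt, Ordinal.add_sub_cancel]

@[simp]
theorem length_append : (append a b).length = a.length + b.length := rfl

@[simp]
theorem length_empty : (empty : TransfiniteWord.{u, v} X).length = 0 := rfl

@[simp]
theorem empty_append : append empty a = a :=
  ext_get fun β => by simp [get_append]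

@[simp]
theorem append_empty : append a empty = a :=
  ext_get fun β => by
    rw [get_append]
    split_ifs with h
    · rfl
    · rw [get_empty, get_of_le (not_lt.mp h)]

theorem append_assoc : append (append a b) c = append a (append b c) :=
  ext_get fun β => by
    by_cases h : β < a.length
    · rw [get_append_of_lt (h.trans_le le_self_add), get_append_of_lt h, get_append_of_lt h]
    · obtain ⟨β, rfl⟩ := exists_add_of_le (not_lt.mp h)
      rw [get_append_add, get_append (a := append a b), get_append (a := b), length_append,
        Ordinal.add_sub_add_cancel, get_append_add]
      simp

theorem append_left_cancel (h : append a b = append a c) : b = c :=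
  ext_get fun β => by rw [← get_append_add (a := a), h, get_append_add]

/-- The word of length `l` with letters `f β`. -/
def ofFun (l : Ordinal.{v}) (f : Ordinal.{v} → X) : TransfiniteWord.{u, v} X :=
  ⟨l, fun β => f β⟩

theorem get_ofFun {l : Ordinal.{v}} {f : Ordinal.{v} → X} {β : Ordinal.{v}} (h : β < l) :
    (ofFun l f).get β = some (f β) :=
  get_of_lt (w := ofFun l f) h

/-- The prefix of `w` of length `min κ |w|`. -/
noncomputable def take (κ : Ordinal.{v}) (w : TransfiniteWord.{u, v} X) :
    TransfiniteWord.{u, v} X :=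
  ⟨min κ w.length, fun β => w.letter ⟨β, (Set.mem_Iio.mp β.2).trans_le (min_le_right _ _)⟩⟩

/-- The suffix of `w` that starts at position `κ`. -/
noncomputable def drop (κ : Ordinal.{v}) (w : TransfiniteWord.{u, v} X) :
    TransfiniteWord.{u, v} X :=
  ⟨w.length - κ, fun β => w.letter ⟨κ + β, Ordinal.lt_sub.mp β.2⟩⟩

theorem get_take {κ β : Ordinal.{v}} (h : β < κ) : (take κ w).get β = w.get β := by
  by_cases h' : β < w.length
  · rw [get_of_lt h', get_of_lt (lt_min h h' : β < (take κ w).length)]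
    rfl
  · rw [get_of_le (not_lt.mp h'), get_of_le ((min_le_right _ _).trans (not_lt.mp h'))]

theorem get_drop {κ β : Ordinal.{v}} : (drop κ w).get β = w.get (κ + β) := by
  by_cases h' : κ + β < w.length
  · rw [get_of_lt h', get_of_lt (Ordinal.lt_sub.mpr h' : β < (drop κ w).length)]
    rfl
  · rw [get_of_le (not_lt.mp h'), get_of_le (Ordinal.sub_le.mpr (not_lt.mp h'))]

theorem length_take {κ : Ordinal.{v}} (h : κ ≤ w.length) : (take κ w).length = κ :=
  min_eq_left h

theorem take_append_drop {κ : Ordinal.{v}} (h : κ ≤ w.length) :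
    append (take κ w) (drop κ w) = w :=
  ext_get fun β => by
    rw [get_append, length_take h]
    split_ifs with h'
    · exact get_take h'
    · rw [get_drop, Ordinal.add_sub_cancel_of_le (not_lt.mp h')]

theorem exists_eq_append_of_append_eq_append (h : append u v = append a b)
    (hl : a.length ≤ u.length) : ∃ m, u = append a m ∧ b = append m v := by
  have hu : u = append a (drop a.length u) := by
    conv_lhs => rw [← take_append_drop hl]
    congr 1
    refine ext_get fun β => ?_
    by_cases hβ : β < a.length
    · rw [get_take hβ, ← get_append_of_lt (hβ.trans_le hl), h, get_append_of_lt hβ]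
    · rw [get_of_le (not_lt.mp hβ), get_of_le (by rw [length_take hl]; exact not_lt.mp hβ)]
  refine ⟨_, hu, append_left_cancel (a := a) ?_⟩
  rw [← append_assoc, ← hu, h]

/-- Levi's lemma: the shorter of the two left factors is a prefix of the other, and left
cancellation handles the rest. -/
theorem append_eq_append_iff :
    append u v = append a b ↔
      (∃ m, u = append a m ∧ b = append m v) ∨ ∃ m, a = append u m ∧ v = append m b := by
  constructor
  · intro h
    rcases le_total a.length u.length with hl | hl
    · exact Or.inl (exists_eq_append_of_append_eq_append h hl)
    · exact Or.inr (exists_eq_append_of_append_eq_append h.symm hl)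
  · rintro (⟨m, rfl, rfl⟩ | ⟨m, rfl, rfl⟩) <;> rw [append_assoc]

theorem append_mem_power_iff {F : Set X} {α : Ordinal.{v}} :
    append a b ∈ power F α ↔
      a.length + b.length < α ∧ (∀ β x, a.get β = some x → x ∈ F) ∧
        ∀ β x, b.get β = some x → x ∈ F := by
  rw [mem_power_iff]
  refine and_congr_right fun _ => ⟨fun h => ⟨fun β x hx => ?_, fun β x hx => ?_⟩,
    fun h β x hx => ?_⟩
  · refine h β x ?_
    rwa [get_append_of_lt]
    by_contra h'
    simp [get_of_le (not_lt.mp h')] at hx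
  · exact h (a.length + β) x (by rwa [get_append_add])
  · rw [get_append] at hx
    split_ifs at hx
    · exact h.1 _ _ hx
    · exact h.2 _ _ hx

@[simp]
theorem product_nil : product ([] : List (Set X × Ordinal.{v})) = {empty} := rfl

@[simp]
theorem product_cons (A : Set X × Ordinal.{v}) (L : List (Set X × Ordinal.{v})) :
    product (A :: L) = concat (power A.1 A.2) (product L) := rfl

theorem concat_assoc (A B C : Set (TransfiniteWord.{u, v} X)) :
    concat (concat A B) C = concat A (concat B C) :=
  Set.image2_assoc fun _ _ _ => append_assoc

@[simp]
theorem concat_empty_left (A : Set (TransfiniteWord.{u, v} X)) : concat {empty} A = A := by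
  simp [concat]

@[simp]
theorem concat_empty_right (A : Set (TransfiniteWord.{u, v} X)) : concat A {empty} = A := by
  simp [concat]

theorem product_append (L M : List (Set X × Ordinal.{v})) :
    product (L ++ M) = concat (product L) (product M) := by
  induction L with
  | nil => simp
  | cons A L ih => simp [ih, concat_assoc]

theorem product_singleton (A : Set X × Ordinal.{v}) : product [A] = power A.1 A.2 := by
  simp

/-- `Subword a b` says that `a` is a subword of `b`. -/
def Subword (a b : TransfiniteWord.{u, v} X) : Prop :=
  ∃ f : Ordinal.{v} → Ordinal.{v}, StrictMonoOn f (Set.Iio a.length) ∧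
    ∀ β < a.length, a.get β = b.get (f β)

theorem Subword.empty (a : TransfiniteWord.{u, v} X) : Subword empty a :=
  ⟨id, strictMono_id.strictMonoOn _, fun _ h => absurd h zero_le.not_gt⟩

theorem Subword.length_le (h : Subword a b) : a.length ≤ b.length := by
  obtain ⟨f, hf, h⟩ := h
  have key : ∀ β : Ordinal.{v}, β < a.length → β ≤ f β := by
    intro β
    -- A strictly increasing map of ordinals never moves a position down.
    induction β using WellFoundedLT.induction with
    | ind β ih =>
      intro hβ
      by_contra hlt
      have h1 := not_le.mp hlt
      exact (ih _ h1 (h1.trans hβ)).not_gt (hf (h1.trans hβ) hβ h1)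
  by_contra hlt
  have h1 := not_le.mp hlt
  have h2 := h _ h1
  rw [get_of_le (key _ h1), get_eq_none_iff] at h2
  exact h2.not_gt h1

theorem Subword.exists_append (h : Subword w (append a b)) :
    ∃ u v, w = append u v ∧ Subword u a ∧ Subword v b := by
  obtain ⟨f, hf, h⟩ := h
  -- `w` is cut at the first position sent into `b`, or at its end if there is none.
  let S : Set Ordinal.{v} := {p | w.length ≤ p ∨ a.length ≤ f p}
  have hS : w.length ∈ S := Or.inl le_rfl
  have hκ : sInf S ≤ w.length := csInf_le' hS
  have hmem : sInf S ∈ S := csInf_mem ⟨_, hS⟩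
  have hlt : ∀ p < sInf S, f p < a.length := fun p hp => by
    by_contra h'
    exact notMem_of_lt_csInf' hp (Or.inr (not_lt.mp h'))
  have hge : ∀ p, sInf S ≤ p → p < w.length → a.length ≤ f p := fun p hp hpw => by
    rcases hmem with h1 | h1
    · exact absurd (h1.trans hp) hpw.not_ge
    · exact h1.trans (hf.monotoneOn (hp.trans_lt hpw) hpw hp)
  refine ⟨take (sInf S) w, drop (sInf S) w, (take_append_drop hκ).symm, ⟨f, ?_, ?_⟩,
    ⟨fun β => f (sInf S + β) - a.length, ?_, ?_⟩⟩
  · exact hf.mono (Set.Iio_subset_Iio (min_le_right _ _))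
  · intro β hβ
    rw [length_take hκ] at hβ
    rw [get_take hβ, h β (hβ.trans_le hκ), get_append_of_lt (hlt β hβ)]
  · intro β hβ γ hγ hβγ
    have hβ' : sInf S + β < w.length := Ordinal.lt_sub.mp hβ
    have hγ' : sInf S + γ < w.length := Ordinal.lt_sub.mp hγ
    show f (sInf S + β) - a.length < f (sInf S + γ) - a.length
    rw [Ordinal.lt_sub, Ordinal.add_sub_cancel_of_le (hge _ le_self_add hβ')]
    exact hf hβ' hγ' (by simpa using hβγ)
  · intro β hβ
    have hβ' : sInf S + β < w.length := Ordinal.lt_sub.mp hβ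
    rw [get_drop, h _ hβ', get_append, if_neg (hge _ le_self_add hβ').not_gt]

theorem Subword.mem_power {F : Set X} {α : Ordinal.{v}} (h : Subword a b) (hb : b ∈ power F α) :
    a ∈ power F α := by
  rw [mem_power_iff] at hb ⊢
  refine ⟨h.length_le.trans_lt hb.1, fun β x hx => ?_⟩
  obtain ⟨f, -, h⟩ := h
  refine hb.2 (f β) x ?_
  rw [← h β, hx]
  by_contra h'
  simp [get_of_le (not_lt.mp h')] at hx

theorem Subword.mem_product {L : List (Set X × Ordinal.{v})} (h : Subword a b)
    (hb : b ∈ product L) : a ∈ product L := by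
  induction L generalizing a b with
  | nil =>
    obtain rfl : b = TransfiniteWord.empty := hb
    have := h.length_le
    exact ext_get fun β => by
      rw [get_empty, get_of_le (this.trans zero_le)]
  | cons A L ih =>
    obtain ⟨p, hp, q, hq, rfl⟩ := hb
    obtain ⟨u, v, rfl, hu, hv⟩ := h.exists_append
    exact ⟨u, hu.mem_power hp, v, ih hv hq, rfl⟩

theorem power_subset_product {L : List (Set X × Ordinal.{v})} (hL : (product L).Nonempty)
    {A : Set X × Ordinal.{v}} (hA : A ∈ L) : power A.1 A.2 ⊆ product L := by
  intro w hw
  induction L with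
  | nil => simp at hA
  | cons B L ih =>
    obtain ⟨_, p, hp, q, hq, -⟩ := hL
    rcases List.mem_cons.mp hA with rfl | hA
    · exact ⟨w, hw, empty, (Subword.empty q).mem_product hq, append_empty⟩
    · exact ⟨empty, (Subword.empty p).mem_power hp, w, ih ⟨q, hq⟩ hA, empty_append⟩

/-- The pairs `(δ, ζ)` with `δ + ζ < α` form a finite union of rectangles. -/
theorem exists_list_add_lt_iff (α : Ordinal.{v}) :
    ∃ T : List (Ordinal.{v} × Ordinal.{v}), (∀ p ∈ T, p.2 ≤ α) ∧
      ∀ δ ζ, δ + ζ < α ↔ ∃ p ∈ T, δ < p.1 ∧ ζ < p.2 := by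
  induction α using WellFoundedLT.induction with
  | ind α ih =>
    rcases eq_or_ne α 0 with rfl | hα
    · exact ⟨[], by simp, fun δ ζ => by simp⟩
    -- Up to the least δ where α - δ drops below α, the condition is just ζ < α, giving one
    -- rectangle. From there on it is the same problem for the smaller ordinal α - δ, so the
    -- recursion terminates.
    let S : Set Ordinal.{v} := {δ | α - δ < α}
    have hS : α ∈ S := by
      show α - α < α
      rw [Ordinal.sub_self]
      exact pos_iff_ne_zero.mpr hα
    have hη : α - sInf S < α := csInf_mem (s := S) ⟨_, hS⟩
    obtain ⟨T, hT, hT'⟩ := ih _ hη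
    have hlt : ∀ δ < sInf S, ∀ ζ < α, δ + ζ < α := fun δ hδ ζ hζ => by
      have : ¬ α - δ < α := fun h => notMem_of_lt_csInf' hδ h
      rw [← Ordinal.lt_sub]
      exact hζ.trans_le (not_lt.mp this)
    refine ⟨(sInf S, α) :: T.map fun p => (sInf S + p.1, p.2), ?_, fun δ ζ => ?_⟩
    · simp only [List.mem_cons, List.mem_map]
      rintro p (rfl | ⟨q, hq, rfl⟩)
      · exact le_rfl
      · exact (hT q hq).trans hη.le
    · by_cases hδ : δ < sInf S
      · simp only [List.mem_cons, List.mem_map]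
        refine ⟨fun h => ⟨_, Or.inl rfl, hδ, le_add_self.trans_lt h⟩, ?_⟩
        rintro ⟨p, rfl | ⟨q, hq, rfl⟩, h1, h2⟩
        · exact hlt δ hδ ζ h2
        · exact hlt δ hδ ζ (h2.trans_le ((hT q hq).trans hη.le))
      · obtain ⟨δ, rfl⟩ := exists_add_of_le (not_lt.mp hδ)
        rw [add_assoc, ← Ordinal.lt_sub, hT']
        simp

/-- The cut between `u` and `v` falls either after the first factor, where induction applies, or
inside it, where the lengths of its two pieces obey one of finitely many rectangular conditions.
Only the ordinals change, so closedness of the letter sets is kept. -/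
theorem exists_list_append_mem_product_iff (L : List (Set X × Ordinal.{v})) :
    ∃ T : List (List (Set X × Ordinal.{v}) × List (Set X × Ordinal.{v})),
      (∀ p ∈ T, (∀ A ∈ p.1, ∃ B ∈ L, A.1 = B.1) ∧ ∀ A ∈ p.2, ∃ B ∈ L, A.1 = B.1) ∧
      ∀ u v, append u v ∈ product L ↔ ∃ p ∈ T, u ∈ product p.1 ∧ v ∈ product p.2 := by
  induction L with
  | nil =>
    refine ⟨[([], [])], by simp, fun u v => ?_⟩
    simp only [product_nil, Set.mem_singleton_iff, List.mem_singleton, exists_eq_left]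
    refine ⟨fun h => ?_, fun h => by rw [h.1, h.2, empty_append]⟩
    have hl : u.length + v.length = 0 := congrArg length h
    have hu : u = empty := ext_get fun β => by
      rw [get_empty, get_of_le (le_self_add.trans (hl.le.trans zero_le))]
    subst hu
    exact ⟨rfl, by rwa [empty_append] at h⟩
  | cons B L ih =>
    obtain ⟨T, hT, hT'⟩ := ih
    obtain ⟨S, -, hS⟩ := exists_list_add_lt_iff B.2
    refine ⟨T.map (fun p => (B :: p.1, p.2)) ++
      S.map (fun p => ([(B.1, p.1)], (B.1, p.2) :: L)), ?_, fun u v => ?_⟩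
    · simp only [List.mem_append, List.mem_map]
      rintro _ (⟨p, hp, rfl⟩ | ⟨p, hp, rfl⟩)
      · refine ⟨fun A hA => ?_, fun A hA => ?_⟩
        · rcases List.mem_cons.mp hA with rfl | hA
          · exact ⟨A, by simp, rfl⟩
          · obtain ⟨C, hC, h⟩ := (hT p hp).1 A hA
            exact ⟨C, by simp [hC], h⟩
        · obtain ⟨C, hC, h⟩ := (hT p hp).2 A hA
          exact ⟨C, by simp [hC], h⟩
      · refine ⟨fun A hA => ⟨B, by simp, by simp_all⟩, fun A hA => ?_⟩
        rcases List.mem_cons.mp hA with rfl | hA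
        · exact ⟨B, by simp, rfl⟩
        · exact ⟨A, by simp [hA], rfl⟩
    · constructor
      · rintro ⟨p, hp, q, hq, h⟩
        rcases append_eq_append_iff.mp h.symm with ⟨m, rfl, rfl⟩ | ⟨m, rfl, rfl⟩
        · obtain ⟨t, ht, h1, h2⟩ := (hT' _ _).mp hq
          exact ⟨(B :: t.1, t.2), List.mem_append_left _ (List.mem_map.mpr ⟨t, ht, rfl⟩),
            ⟨p, hp, m, h1, rfl⟩, h2⟩
        · obtain ⟨h0, h1, h2⟩ := append_mem_power_iff.mp hp
          obtain ⟨s, hs, h3, h4⟩ := (hS _ _).mp h0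
          refine ⟨_, List.mem_append_right _ (List.mem_map.mpr ⟨s, hs, rfl⟩), ?_, ?_⟩
          · rw [product_singleton]
            exact mem_power_iff.mpr ⟨h3, h1⟩
          · exact ⟨m, mem_power_iff.mpr ⟨h4, h2⟩, q, hq, rfl⟩
      · rintro ⟨p, hp, hu, hv⟩
        rcases List.mem_append.mp hp with hp | hp
        · obtain ⟨t, ht, rfl⟩ := List.mem_map.mp hp
          obtain ⟨p, hp, m, hm, rfl⟩ := hu
          rw [append_assoc]
          exact ⟨p, hp, _, (hT' _ _).mpr ⟨t, ht, hm, hv⟩, rfl⟩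
        · obtain ⟨s, hs, rfl⟩ := List.mem_map.mp hp
          rw [product_singleton] at hu
          obtain ⟨m, hm, q, hq, rfl⟩ := hv
          rw [← append_assoc]
          have hu' := mem_power_iff.mp hu
          have hm' := mem_power_iff.mp hm
          exact ⟨_, append_mem_power_iff.mpr
            ⟨(hS _ _).mpr ⟨s, hs, hu'.1, hm'.1⟩, hu'.2, hm'.2⟩, q, hq, rfl⟩

end Words

end TransfiniteWord

/-! ### Noetherian subspaces and irreducible sets in general topology. -/

section Topology

variable {α : Type u} {β : Type v} [TopologicalSpace α] [TopologicalSpace β]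

/-- A set all of whose subsets are compact, that is, a Noetherian subspace. -/
def IsNoetherianSet (s : Set α) : Prop :=
  ∀ t ⊆ s, IsCompact t

theorem IsNoetherianSet.mono {s t : Set α} (ht : IsNoetherianSet t) (h : s ⊆ t) :
    IsNoetherianSet s :=
  fun r hr => ht r (hr.trans h)

theorem IsNoetherianSet.union {s t : Set α} (hs : IsNoetherianSet s) (ht : IsNoetherianSet t) :
    IsNoetherianSet (s ∪ t) := fun r hr => by
  rw [← inter_eq_left.mpr hr, inter_union_distrib_left]
  exact (hs _ inter_subset_right).union (ht _ inter_subset_right)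

theorem IsNoetherianSet.image {s : Set α} (hs : IsNoetherianSet s) {f : α → β}
    (hf : Continuous f) : IsNoetherianSet (f '' s) := fun t ht => by
  obtain ⟨r, hr, rfl⟩ := subset_image_iff.mp ht
  exact (hs r hr).image hf

/-- A set is Noetherian if its proper subbasic closed subsets are. -/
theorem IsNoetherianSet.of_subbasis {g : Set (Set α)} (hg : ‹TopologicalSpace α› = generateFrom g)
    {s : Set α} (h : ∀ u ∈ g, (s ∩ u).Nonempty → IsNoetherianSet (s \ u)) :
    IsNoetherianSet s := fun t ht => by
  refine isCompact_generateFrom hg fun P hP htP => ?_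
  rcases t.eq_empty_or_nonempty with rfl | ⟨x, hx⟩
  · exact ⟨∅, empty_subset _, finite_empty, empty_subset _⟩
  -- By Alexander's theorem the cover may be taken subbasic; any one member that meets `t` leaves a
  -- remainder that is compact by hypothesis.
  obtain ⟨u, hu, hxu⟩ := htP hx
  have hc : IsCompact (t \ u) :=
    h u (hP hu) ⟨x, ht hx, hxu⟩ _ (sdiff_subset_sdiff_left ht)
  obtain ⟨Q, hQ, hQf, hQt⟩ := hc.elim_finite_subcover_image (b := P) (c := id)
    (fun v hv => by rw [hg]; exact isOpen_generateFrom_of_mem (hP hv))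
    (sdiff_subset.trans (htP.trans sUnion_eq_biUnion.subset))
  refine ⟨insert u Q, insert_subset hu hQ, hQf.insert u, fun y hy => ?_⟩
  by_cases hyu : y ∈ u
  · exact ⟨u, mem_insert _ _, hyu⟩
  · obtain ⟨v, hv, hyv⟩ := mem_iUnion₂.mp (hQt ⟨hy, hyu⟩)
    exact ⟨v, mem_insert_of_mem _ hv, hyv⟩

theorem isNoetherianSet_univ_iff : IsNoetherianSet (univ : Set α) ↔ NoetherianSpace α := by
  rw [noetherianSpace_iff_isCompact]
  exact ⟨fun h s => h s (subset_univ s), fun h s _ => h s⟩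

theorem IsNoetherianSet.prod_univ [NoetherianSpace α] [NoetherianSpace β] :
    IsNoetherianSet (univ : Set (α × β)) := by
  have key : ∀ p : Closeds α × Closeds β, IsNoetherianSet ((p.1 : Set α) ×ˢ (p.2 : Set β)) := by
    intro p
    induction p using WellFoundedLT.induction with
    | ind p ih =>
      obtain ⟨A, B⟩ := p
      refine IsNoetherianSet.of_subbasis prod_eq_generateFrom ?_
      rintro _ ⟨U, V, hU, hV, rfl⟩ ⟨⟨x, y⟩, ⟨hxA, hyB⟩, hxU, hyV⟩
      let A' : Closeds α := ⟨A \ U, A.isClosed.sdiff hU⟩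
      let B' : Closeds β := ⟨B \ V, B.isClosed.sdiff hV⟩
      have hA : A' < A := by
        refine lt_of_le_of_ne (fun z hz => hz.1) fun h => ?_
        have : x ∈ A' := h ▸ hxA
        exact this.2 hxU
      have hB : B' < B := by
        refine lt_of_le_of_ne (fun z hz => hz.1) fun h => ?_
        have : y ∈ B' := h ▸ hyB
        exact this.2 hyV
      -- Removing U × V from A × B leaves (A \ U) × B and A × (B \ V), both indexed by smaller
      -- pairs.
      refine ((ih (A', B) (Prod.mk_lt_mk_of_lt_of_le hA le_rfl)).union
        (ih (A, B') (Prod.mk_lt_mk_of_le_of_lt le_rfl hB))).mono ?_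
      rintro ⟨a, b⟩ ⟨⟨ha, hb⟩, h⟩
      by_cases haU : a ∈ U
      · exact Or.inr ⟨ha, hb, fun hbV => h ⟨haU, hbV⟩⟩
      · exact Or.inl ⟨⟨ha, haU⟩, hb⟩
  have := key (⊤, ⊤)
  simpa using this

theorem IsNoetherianSet.prod {s : Set α} {t : Set β} (hs : IsNoetherianSet s)
    (ht : IsNoetherianSet t) : IsNoetherianSet (s ×ˢ t) := by
  have := (noetherianSpace_set_iff s).mpr hs
  have := (noetherianSpace_set_iff t).mpr ht
  have h := (IsNoetherianSet.prod_univ (α := s) (β := t)).image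
    (continuous_subtype_val.prodMap continuous_subtype_val)
  rwa [image_univ, range_prodMap, Subtype.range_val, Subtype.range_val] at h

/-- The irreducible closed subsets of a product space are products. -/
theorem IsIrreducible.eq_closure_prod_closure {z : Set (α × β)} (hz : IsIrreducible z)
    (hc : IsClosed z) : z = closure (Prod.fst '' z) ×ˢ closure (Prod.snd '' z) := by
  refine Subset.antisymm (fun p hp => ⟨subset_closure (mem_image_of_mem _ hp),
    subset_closure (mem_image_of_mem _ hp)⟩) ?_
  rintro ⟨x, y⟩ ⟨hx, hy⟩
  by_contra hxy
  obtain ⟨U, V, hU, hV, hxU, hyV, hUV⟩ := isOpen_prod_iff.mp hc.isOpen_compl x y hxy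
  obtain ⟨_, hpU, p, hp, rfl⟩ := mem_closure_iff.mp hx U hU hxU
  obtain ⟨_, hqV, q, hq, rfl⟩ := mem_closure_iff.mp hy V hV hyV
  obtain ⟨r, hr, h1, h2⟩ := hz.2 _ _ (hU.preimage continuous_fst) (hV.preimage continuous_snd)
    ⟨p, hp, hpU⟩ ⟨q, hq, hqV⟩
  exact hUV ⟨h1, h2⟩ hr

/-- If an irreducible closed set misses a point, so does some subbasic closed set containing it. -/
theorem IsIrreducible.exists_subset_compl_of_notMem {g : Set (Set α)}
    (hg : ‹TopologicalSpace α› = generateFrom g) {s : Set α} (hs : IsIrreducible s)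
    (hc : IsClosed s) {x : α} (hx : x ∉ s) : ∃ u ∈ g, x ∈ u ∧ s ⊆ uᶜ := by
  classical
  obtain ⟨_, ⟨f, ⟨hf, hfg⟩, rfl⟩, hxf, hfs⟩ :=
    (isTopologicalBasis_of_subbasis hg).exists_subset_of_mem_open hx hc.isOpen_compl
  -- The complement of a basic neighbourhood is a finite union of subbasic closed sets, so an
  -- irreducible set inside it lies in one of them.
  obtain ⟨z, hz, hsz⟩ := isIrreducible_iff_sUnion_isClosed.mp hs (hf.toFinset.image compl)
    (fun z hz => by
      obtain ⟨u, hu, rfl⟩ := Finset.mem_image.mp hz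
      rw [isClosed_compl_iff, hg]
      exact isOpen_generateFrom_of_mem (hfg (hf.mem_toFinset.mp hu)))
    (fun y hy => by
      by_contra h
      refine hfs (fun u hu => ?_) hy
      by_contra hyu
      exact h ⟨uᶜ, Finset.mem_coe.mpr
        (Finset.mem_image_of_mem _ (hf.mem_toFinset.mpr hu)), hyu⟩)
  obtain ⟨u, hu, rfl⟩ := Finset.mem_image.mp hz
  exact ⟨u, hfg (hf.mem_toFinset.mp hu), hxf u (hf.mem_toFinset.mp hu), hsz⟩

end Topology

namespace TransfiniteWord

/-! ### The topology on all words and its Noetherianity. -/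

section

variable {X : Type u} [TopologicalSpace X]

/-- The complements of the products of powers of closed sets. -/
def subbasis (X : Type u) [TopologicalSpace X] : Set (Set (TransfiniteWord.{u, v} X)) :=
  {U | ∃ L : List (Set X × Ordinal.{v}), (∀ A ∈ L, IsClosed A.1) ∧ U = (product L)ᶜ}

/-- The regular subword topology on the set of all words. -/
@[reducible]
def wordTopology (X : Type u) [TopologicalSpace X] : TopologicalSpace (TransfiniteWord.{u, v} X) :=
  generateFrom (subbasis X)

theorem regularSubwordTopology_eq_induced (Y : Set (TransfiniteWord.{u, v} X)) :
    regularSubwordTopology Y = (wordTopology X).induced Subtype.val := by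
  rw [induced_generateFrom_eq]
  unfold regularSubwordTopology
  congr 1
  ext U
  constructor
  · rintro ⟨L, hL, rfl⟩
    exact ⟨_, ⟨L, hL, rfl⟩, rfl⟩
  · rintro ⟨_, ⟨L, hL, rfl⟩, rfl⟩
    exact ⟨L, hL, rfl⟩

attribute [local instance] wordTopology

theorem isClosed_product {L : List (Set X × Ordinal.{v})} (hL : ∀ A ∈ L, IsClosed A.1) :
    IsClosed (product L) := by
  rw [← isOpen_compl_iff]
  exact isOpen_generateFrom_of_mem ⟨L, hL, rfl⟩

theorem isClosed_power {F : Set X} (hF : IsClosed F) (γ : Ordinal.{v}) :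
    IsClosed (power F γ) := by
  rw [← product_singleton (F, γ)]
  exact isClosed_product (by simpa using hF)

theorem continuous_append :
    Continuous fun p : TransfiniteWord.{u, v} X × TransfiniteWord.{u, v} X =>
      append p.1 p.2 := by
  refine continuous_generateFrom_iff.mpr ?_
  rintro _ ⟨L, hL, rfl⟩
  rw [preimage_compl, isOpen_compl_iff]
  obtain ⟨T, hT, hT'⟩ := exists_list_append_mem_product_iff L
  have : (fun p : TransfiniteWord.{u, v} X × TransfiniteWord.{u, v} X => append p.1 p.2) ⁻¹'
      product L = ⋃ p ∈ {p | p ∈ T}, product p.1 ×ˢ product p.2 := by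
    ext p
    simp only [mem_preimage, hT', mem_iUnion, mem_prod, mem_ofPred_eq, exists_prop]
  rw [this]
  refine T.finite_toSet.isClosed_biUnion fun p hp => ?_
  refine (isClosed_product fun A hA => ?_).prod (isClosed_product fun A hA => ?_)
  · obtain ⟨B, hB, h⟩ := (hT p hp).1 A hA
    exact h ▸ hL B hB
  · obtain ⟨B, hB, h⟩ := (hT p hp).2 A hA
    exact h ▸ hL B hB

theorem _root_.IsOpen.mem_of_subword {U : Set (TransfiniteWord.{u, v} X)} (hU : IsOpen U)
    {a b : TransfiniteWord.{u, v} X} (h : Subword a b) (ha : a ∈ U) : b ∈ U := by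
  induction hU with
  | basic s hs =>
    obtain ⟨L, -, rfl⟩ := hs
    exact fun hb => ha (h.mem_product hb)
  | univ => trivial
  | inter s t _ _ hs ht => exact ⟨hs ha.1, ht ha.2⟩
  | sUnion S _ ih =>
    obtain ⟨s, hs, has⟩ := ha
    exact ⟨s, hs, ih s hs has⟩

-- Every factor of a word in F^{<γ} again lies in F^{<γ}, so the constraint can be imposed factor by
-- factor.
omit [TopologicalSpace X] in
theorem power_inter_product_subset (F : Set X) (γ : Ordinal.{v})
    (L : List (Set X × Ordinal.{v})) :
    power F γ ∩ product L ⊆ product (L.map fun A => (F ∩ A.1, min γ A.2)) := by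
  induction L with
  | nil => exact inter_subset_right
  | cons A L ih =>
    rintro _ ⟨h, p, hp, q, hq, rfl⟩
    obtain ⟨h0, h1, h2⟩ := append_mem_power_iff.mp h
    have hp' := mem_power_iff.mp hp
    exact ⟨p, mem_power_iff.mpr ⟨lt_min (le_self_add.trans_lt h0) hp'.1,
        fun β x hx => ⟨h1 β x hx, hp'.2 β x hx⟩⟩,
      q, ih ⟨mem_power_iff.mpr ⟨le_add_self.trans_lt h0, h2⟩, hq⟩, rfl⟩

/-- Induction on powers of closed sets: if `P` passes to subsets and to products, it is enough to
cover, under the assumption that `P` holds for all smaller powers. -/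
theorem power_inter_product_induction [NoetherianSpace X]
    {P : Set (TransfiniteWord.{u, v} X) → Prop} (hP : ∀ s t, s ⊆ t → P t → P s)
    (hprod : ∀ L : List (Set X × Ordinal.{v}), (∀ A ∈ L, IsClosed A.1) →
      (∀ A ∈ L, P (power A.1 A.2)) → P (product L))
    (hstep : ∀ (F : Set X) (γ : Ordinal.{v}), IsClosed F →
      (∀ δ < γ, P (power F δ)) →
      (∀ L : List (Set X × Ordinal.{v}), (∀ A ∈ L, IsClosed A.1) →
        ¬ power F γ ⊆ product L → P (power F γ ∩ product L)) → P (power F γ))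
    (F : Set X) (hF : IsClosed F) (γ : Ordinal.{v}) : P (power F γ) := by
  have hempty : P ∅ := hP _ _ (empty_subset _) (hprod [] (by simp) (by simp))
  have key : ∀ p : Closeds X × Ordinal.{v}, P (power (p.1 : Set X) p.2) := by
    intro p
    induction p using WellFoundedLT.induction with
    | ind p ih =>
      obtain ⟨F, γ⟩ := p
      refine hstep F γ F.isClosed
        (fun δ hδ => ih (F, δ) (Prod.mk_lt_mk_of_le_of_lt le_rfl hδ)) fun L hL hn => ?_
      rcases (product L).eq_empty_or_nonempty with h0 | h0
      · rw [h0, inter_empty]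
        exact hempty
      refine hP _ _ (power_inter_product_subset _ _ _) (hprod _ ?_ ?_)
      · simp only [List.mem_map]
        rintro _ ⟨A, hA, rfl⟩
        exact F.isClosed.inter (hL A hA)
      · simp only [List.mem_map]
        rintro _ ⟨A, hA, rfl⟩
        -- If the pair did not decrease, F^{<γ} would lie in this one factor, hence in the whole
        -- product, which is nonempty.
        refine ih (⟨F ∩ A.1, F.isClosed.inter (hL A hA)⟩, min γ A.2)
          (lt_of_le_of_ne ⟨inter_subset_left, min_le_left _ _⟩ fun h => hn ?_)
        rw [Prod.mk.injEq] at h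
        have h1 : (F : Set X) ∩ A.1 = F := congrArg (fun K : Closeds X => (K : Set X)) h.1
        exact (power_mono (inter_eq_left.mp h1) (min_eq_left_iff.mp h.2)).trans
          (power_subset_product h0 hA)
  exact key (⟨F, hF⟩, γ)

theorem isNoetherianSet_product {L : List (Set X × Ordinal.{v})}
    (hL : ∀ A ∈ L, IsNoetherianSet (power A.1 A.2)) : IsNoetherianSet (product L) := by
  induction L with
  | nil =>
    intro t ht
    exact ((finite_singleton _).subset ht).isCompact
  | cons A L ih =>
    rw [List.forall_mem_cons] at hL
    rw [product_cons, concat, ← image_prod]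
    exact (hL.1.prod (ih hL.2)).image continuous_append

theorem isNoetherianSet_of_inter_product {S : Set (TransfiniteWord.{u, v} X)}
    (h : ∀ L : List (Set X × Ordinal.{v}), (∀ A ∈ L, IsClosed A.1) →
      ¬ S ⊆ product L → IsNoetherianSet (S ∩ product L)) : IsNoetherianSet S := by
  refine IsNoetherianSet.of_subbasis rfl ?_
  rintro _ ⟨L, hL, rfl⟩ hn
  rw [sdiff_compl]
  exact h L hL (inter_compl_nonempty_iff.mp hn)

theorem isNoetherianSet_power [NoetherianSpace X] (F : Set X) (hF : IsClosed F)
    (γ : Ordinal.{v}) : IsNoetherianSet (power F γ) :=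
  power_inter_product_induction (fun _ _ hst ht => ht.mono hst)
    (fun _ _ => isNoetherianSet_product)
    (fun _ _ _ _ h => isNoetherianSet_of_inter_product h) F hF γ

/-- The set of all words is not a power, its lengths being unbounded, but its subbasic closed
subsets are products of powers, which suffices. -/
instance [NoetherianSpace X] : NoetherianSpace (TransfiniteWord.{u, v} X) :=
  isNoetherianSet_univ_iff.mp <| isNoetherianSet_of_inter_product fun _ hL _ =>
    (isNoetherianSet_product fun A hA => isNoetherianSet_power _ (hL A hA) _).mono
      inter_subset_right

/-! ### Irreducible closed sets and concatenation. -/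

theorem _root_.IsIrreducible.concat {A B : Set (TransfiniteWord.{u, v} X)} (hA : IsIrreducible A)
    (hB : IsIrreducible B) : IsIrreducible (concat A B) := by
  refine ⟨hA.1.image2 hB.1, ?_⟩
  rintro U V hU hV ⟨_, ⟨a, ha, b, hb, rfl⟩, habU⟩ ⟨_, ⟨c, hc, d, hd, rfl⟩, hcdV⟩
  have hl (b : TransfiniteWord.{u, v} X) : Continuous fun a => append a b :=
    continuous_append.comp (continuous_id.prodMk continuous_const)
  have hr (a : TransfiniteWord.{u, v} X) : Continuous fun b => append a b :=
    continuous_append.comp (continuous_const.prodMk continuous_id)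
  -- A left factor `e` good for both `b` and `d` is chosen first, then a right factor good for both
  -- open sets.
  obtain ⟨e, he, h1, h2⟩ := hA.2 _ _ (hU.preimage (hl b)) (hV.preimage (hl d))
    ⟨a, ha, habU⟩ ⟨c, hc, hcdV⟩
  obtain ⟨f, hf, h3, h4⟩ := hB.2 _ _ (hU.preimage (hr e)) (hV.preimage (hr e))
    ⟨b, hb, h1⟩ ⟨d, hd, h2⟩
  exact ⟨_, ⟨e, he, f, hf, rfl⟩, h3, h4⟩

theorem isIrreducible_product {L : List (Set X × Ordinal.{v})}
    (hL : ∀ A ∈ L, IsIrreducible (power A.1 A.2)) : IsIrreducible (product L) := by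
  induction L with
  | nil => exact isIrreducible_singleton
  | cons A L ih =>
    rw [List.forall_mem_cons] at hL
    exact hL.1.concat (ih hL.2)

/-- A product of atoms with non-empty letter sets. -/
def IsAtomProduct (C : Set (TransfiniteWord.{u, v} X)) : Prop :=
  ∃ L : List (Set X × Ordinal.{v}), (∀ A ∈ L, IsAtomExpr A ∧ A.1.Nonempty) ∧ C = product L

/-- All irreducible closed subsets of `S` are products of atoms. -/
def HasAtomProducts (S : Set (TransfiniteWord.{u, v} X)) : Prop :=
  ∀ C ⊆ S, IsIrreducible C → IsClosed C → IsAtomProduct C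

theorem isAtomProduct_empty : IsAtomProduct ({empty} : Set (TransfiniteWord.{u, v} X)) :=
  ⟨[], by simp, rfl⟩

theorem hasAtomProducts_singleton :
    HasAtomProducts ({empty} : Set (TransfiniteWord.{u, v} X)) := fun C hC hCi _ => by
  rw [(subset_singleton_iff_eq.mp hC).resolve_left hCi.1.ne_empty]
  exact isAtomProduct_empty

theorem IsAtomProduct.concat {A B : Set (TransfiniteWord.{u, v} X)} (hA : IsAtomProduct A)
    (hB : IsAtomProduct B) : IsAtomProduct (concat A B) := by
  obtain ⟨L, hL, rfl⟩ := hA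
  obtain ⟨M, hM, rfl⟩ := hB
  exact ⟨L ++ M, fun A hA => (List.mem_append.mp hA).elim (hL A) (hM A), (product_append L M).symm⟩

theorem IsAtomProduct.isClosed {A : Set (TransfiniteWord.{u, v} X)} (hA : IsAtomProduct A) :
    IsClosed A := by
  obtain ⟨L, hL, rfl⟩ := hA
  exact isClosed_product fun A hA => (hL A hA).1.isClosed

theorem HasAtomProducts.concat [NoetherianSpace X] {A B : Set (TransfiniteWord.{u, v} X)}
    (hA : HasAtomProducts A) (hB : HasAtomProducts B) (hAc : IsClosed A) (hBc : IsClosed B) :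
    HasAtomProducts (concat A B) := by
  classical
  intro C hC hCi hCc
  have : NoetherianSpace (TransfiniteWord.{u, v} X × TransfiniteWord.{u, v} X) :=
    isNoetherianSet_univ_iff.mp IsNoetherianSet.prod_univ
  obtain ⟨S, hSf, hSc, hSi, hS⟩ := NoetherianSpace.exists_finite_set_isClosed_irreducible
    ((hAc.prod hBc).inter (hCc.preimage continuous_append))
  have hsub : ∀ z ∈ S, z ⊆ A ×ˢ B ∩
      (fun p : TransfiniteWord.{u, v} X × TransfiniteWord.{u, v} X => append p.1 p.2) ⁻¹' C :=
    fun z hz => hS ▸ subset_sUnion_of_mem hz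
  -- The images of the finitely many components cover `C`, so the closure of one of them contains
  -- `C`.
  obtain ⟨_, hz', hCz⟩ := isIrreducible_iff_sUnion_isClosed.mp hCi
    (hSf.toFinset.image fun z => closure ((fun p => append p.1 p.2) '' z))
    (by simp) (fun w hw => by
      obtain ⟨a, ha, b, hb, rfl⟩ := hC hw
      have hab : (a, b) ∈ ⋃₀ S := hS ▸ ⟨⟨ha, hb⟩, hw⟩
      obtain ⟨z, hz, habz⟩ := hab
      exact ⟨_, Finset.mem_coe.mpr (Finset.mem_image_of_mem _ (hSf.mem_toFinset.mpr hz)),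
        subset_closure ⟨_, habz, rfl⟩⟩)
  obtain ⟨z, hz, rfl⟩ := Finset.mem_image.mp hz'
  rw [hSf.mem_toFinset] at hz
  have hzi := hSi z hz
  have h1 : IsAtomProduct (closure (Prod.fst '' z)) :=
    hA _ (closure_minimal (image_subset_iff.mpr fun p hp => (hsub z hz hp).1.1) hAc)
      (hzi.image _ continuous_fst.continuousOn).closure isClosed_closure
  have h2 : IsAtomProduct (closure (Prod.snd '' z)) :=
    hB _ (closure_minimal (image_subset_iff.mpr fun p hp => (hsub z hz hp).1.2) hBc)
      (hzi.image _ continuous_snd.continuousOn).closure isClosed_closure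
  have h12 := h1.concat h2
  rw [TransfiniteWord.concat, ← image_prod, ← hzi.eq_closure_prod_closure (hSc z hz)] at h12
  -- The component is a rectangle, so its image is a product of atoms and already closed.
  rw [h12.isClosed.closure_eq] at hCz
  rwa [hCz.antisymm (image_subset_iff.mpr fun p hp => (hsub z hz hp).2)]

theorem hasAtomProducts_product [NoetherianSpace X] {L : List (Set X × Ordinal.{v})}
    (hLc : ∀ A ∈ L, IsClosed A.1) (hL : ∀ A ∈ L, HasAtomProducts (power A.1 A.2)) :
    HasAtomProducts (product L) := by
  induction L with
  | nil => exact hasAtomProducts_singleton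
  | cons A L ih =>
    rw [List.forall_mem_cons] at hL hLc
    exact hL.1.concat (ih hLc.2 hL.2) (isClosed_power hLc.1 _) (isClosed_product hLc.2)

end

end TransfiniteWord

namespace TransfiniteWord

/-! ### Ordinal arithmetic of bounds. -/

section Bounds

theorem not_isIndecomposable_omega0_opow_add_one (β : Ordinal.{v}) :
    ¬ IsIndecomposable (ω ^ β + 1) := by
  rintro ⟨γ, h⟩
  have h1 := isPrincipal_add_omega0_opow γ
  rw [← h] at h1
  have h0 : (0 : Ordinal.{v}) < ω ^ β := opow_pos _ omega0_pos
  have h2 : ω ^ β < ω ^ β + 1 := lt_add_one _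
  have h3 := h1 h2 h2
  refine h3.not_ge ?_
  have : (1 : Ordinal.{v}) ≤ ω ^ β := Order.one_le_iff_pos.mpr h0
  simpa using this

/-- Ordinals that are neither 0 nor a power of ω split additively. The form c + 1 < γ is what
`power_subset_concat` needs: it is automatic at limits, and for γ = a + 1 one splits `a` instead. -/
theorem exists_le_add_of_not_isBound {γ : Ordinal.{v}} (h0 : γ ≠ 0) (h : ¬ IsBound γ) :
    ∃ c d, c + 1 < γ ∧ d < γ ∧ γ ≤ c + d := by
  have key : ∀ δ : Ordinal.{v}, δ ≠ 0 → (∀ β : Ordinal.{v}, δ ≠ ω ^ β) →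
      ∃ a < δ, ∃ b < δ, δ ≤ a + b := fun δ hδ hδ' => by
    rw [← not_isPrincipal_iff, isPrincipal_add_iff_zero_or_omega0_opow]
    rintro (h | ⟨β, h⟩)
    · exact hδ h
    · exact hδ' β h.symm
  by_cases hs : ∃ a, γ = a + 1
  · obtain ⟨a, rfl⟩ := hs
    have ha : a ≠ 0 := by
      rintro rfl
      exact h ⟨0, Or.inl (by simp)⟩
    obtain ⟨c, hc, d, hd, hcd⟩ := key a ha fun β hβ => h ⟨β, Or.inr (by rw [hβ])⟩
    refine ⟨c, d + 1, by simpa using hc, by simpa using hd, ?_⟩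
    rw [← add_assoc]
    gcongr
  · obtain ⟨a, ha, b, hb, hab⟩ := key γ h0 fun β hβ => h ⟨β, Or.inl hβ⟩
    exact ⟨a, b, lt_of_le_of_ne (Order.add_one_le_of_lt ha) fun h' => hs ⟨a, h'.symm⟩, hb, hab⟩

theorem two_mul_omega0_opow {β : Ordinal.{v}} (hβ : β ≠ 0) : 2 * ω ^ β = ω ^ β := by
  have h : (2 : Ordinal.{v}) < ω := by exact_mod_cast natCast_lt_omega0 2
  exact mul_omega0_dvd two_pos h (by simpa using opow_dvd_opow ω (Order.one_le_iff_ne_zero.mpr hβ))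

theorem IsBound.two_mul_lt {γ l : Ordinal.{v}} (hγ : IsBound γ) (h2 : γ ≠ ω ^ (0 : Ordinal.{v}) + 1)
    (hl : l < γ) : 2 * l < γ := by
  obtain ⟨β, rfl | rfl⟩ := hγ
  · rcases eq_or_ne β 0 with rfl | hβ
    · have : l = 0 := by simpa using hl
      simp [this]
    · rw [← two_mul_omega0_opow hβ]
      exact mul_lt_mul_of_pos_left hl two_pos
  · have hβ : β ≠ 0 := by
      rintro rfl
      exact h2 rfl
    rw [Order.lt_add_one_iff] at hl ⊢
    rw [← two_mul_omega0_opow hβ]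
    gcongr

end Bounds

/-! ### Irreducibility of atoms and the shape of irreducible closed sets. -/

section Atoms

variable {X : Type u}

theorem ofFun_mem_power {F : Set X} {l γ : Ordinal.{v}} {f : Ordinal.{v} → X} (hl : l < γ)
    (hf : ∀ β < l, f β ∈ F) : ofFun l f ∈ power F γ :=
  ⟨hl, fun β => hf β β.2⟩

/-- Any two words with letters in `F` are subwords of a word of at most twice their length. -/
theorem exists_subword_subword {F : Set X} (hF : F.Nonempty) {γ : Ordinal.{v}}
    (hγ : ∀ l < γ, 2 * l < γ) {a b : TransfiniteWord.{u, v} X} (ha : a ∈ power F γ)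
    (hb : b ∈ power F γ) : ∃ c ∈ power F γ, Subword a c ∧ Subword b c := by
  obtain ⟨x, hx⟩ := hF
  rw [mem_power_iff] at ha hb
  have hget : ∀ {w : TransfiniteWord.{u, v} X} {β : Ordinal.{v}}, β < w.length →
      w.get β = some ((w.get β).getD x) := fun h => by simp [get_of_lt h]
  have hmem : ∀ w : TransfiniteWord.{u, v} X, (∀ β y, w.get β = some y → y ∈ F) →
      ∀ β, (w.get β).getD x ∈ F := fun w hw β => by
    cases h : w.get β with
    | none => exact hx
    | some y => exact hw β y h
  -- Interleaving: `a` sits at the positions 2β and `b` at 2β + 1, with `x` as padding past the end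
  -- of either word.
  let f : Ordinal.{v} → X := fun ρ =>
    if ρ % 2 = 0 then (a.get (ρ / 2)).getD x else (b.get (ρ / 2)).getD x
  have hf (β : Ordinal.{v}) : f (2 * β) = (a.get β).getD x := by
    simp [f, mul_mod, mul_div_cancel]
  have hf' (β : Ordinal.{v}) : f (2 * β + 1) = (b.get β).getD x := by
    have h12 : (1 : Ordinal.{v}) < 2 := one_lt_two
    simp [f, mul_add_mod_self, mul_add_div, mod_eq_of_lt h12, div_eq_zero_of_lt h12]
  have hodd {β δ : Ordinal.{v}} (h : β < δ) : 2 * β + 1 < 2 * δ := by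
    calc 2 * β + 1 < 2 * β + 2 := by simp
      _ = 2 * (β + 1) := by rw [mul_add, mul_one]
      _ ≤ 2 * δ := by gcongr; exact Order.add_one_le_of_lt h
  refine ⟨ofFun (2 * max a.length b.length) f,
    ofFun_mem_power (hγ _ (max_lt ha.1 hb.1)) fun β _ => ?_, ⟨fun β => 2 * β, ?_, ?_⟩,
    ⟨fun β => 2 * β + 1, ?_, ?_⟩⟩
  · simp only [f]
    split_ifs
    · exact hmem a ha.2 _
    · exact hmem b hb.2 _
  · exact fun β _ δ _ h => mul_lt_mul_of_pos_left h two_pos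
  · intro β hβ
    rw [get_ofFun (mul_lt_mul_of_pos_left (lt_max_of_lt_left hβ) two_pos), hf, ← hget hβ]
  · exact fun β _ δ _ h => (hodd h).trans (lt_add_one _)
  · intro β hβ
    rw [get_ofFun (hodd (lt_max_of_lt_right hβ)), hf', ← hget hβ]

theorem eq_empty_of_length_eq_zero {w : TransfiniteWord.{u, v} X} (h : w.length = 0) : w = empty :=
  ext_get fun β => by rw [get_empty, get_of_le (h.le.trans zero_le)]

theorem power_subset_concat {F : Set X} {c d γ : Ordinal.{v}} (hc : c < γ) (h : γ ≤ c + d) :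
    power F γ ⊆ concat (power F (c + 1)) (power F d) := by
  intro w hw
  have hd : 0 < d := by
    rw [pos_iff_ne_zero]
    rintro rfl
    rw [add_zero] at h
    exact hc.not_ge h
  rcases le_total w.length c with hwc | hwc
  · exact ⟨w, ⟨Order.lt_add_one_iff.mpr hwc, hw.2⟩, empty,
      (Subword.empty _).mem_power (F := F) (b := empty)
        (mem_power_iff.mpr ⟨hd, by simp⟩), append_empty⟩
  · have hw' : append (take c w) (drop c w) ∈ power F γ := by rwa [take_append_drop hwc]
    obtain ⟨-, h1, h2⟩ := append_mem_power_iff.mp hw'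
    refine ⟨_, mem_power_iff.mpr ⟨?_, h1⟩, _, mem_power_iff.mpr ⟨?_, h2⟩, take_append_drop hwc⟩
    · rw [length_take hwc]
      exact lt_add_one c
    · exact (Ordinal.sub_lt_of_le hwc).mpr (hw.1.trans_le h)

/-- The one-letter word. -/
def single (x : X) : TransfiniteWord.{u, v} X :=
  ofFun 1 fun _ => x

theorem single_mem_power_iff {x : X} {F : Set X} {γ : Ordinal.{v}} :
    single x ∈ power F γ ↔ 1 < γ ∧ x ∈ F :=
  and_congr_right fun _ => ⟨fun h => h ⟨0, mem_Iio.mpr zero_lt_one⟩, fun h _ => h⟩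

theorem single_mem_product_iff {x : X} {L : List (Set X × Ordinal.{v})} :
    single x ∈ product L ↔ (product L).Nonempty ∧ ∃ A ∈ L, 1 < A.2 ∧ x ∈ A.1 := by
  refine ⟨fun h => ⟨⟨_, h⟩, ?_⟩, fun ⟨h, A, hA, h'⟩ =>
    power_subset_product h hA (single_mem_power_iff.mpr h')⟩
  induction L with
  | nil => exact absurd (congrArg length (h : single x = empty)) one_ne_zero
  | cons A L ih =>
    obtain ⟨p, hp, q, hq, hpq⟩ := h
    have hl : p.length + q.length = 1 := congrArg length hpq
    rcases eq_or_ne p.length 0 with h0 | h0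
    · rw [eq_empty_of_length_eq_zero h0, empty_append] at hpq
      obtain ⟨B, hB, h⟩ := ih (hpq ▸ hq)
      exact ⟨B, List.mem_cons_of_mem _ hB, h⟩
    · have hq0 : q.length = 0 := by
        by_contra hq0
        have h1 := add_le_add (Order.one_le_iff_ne_zero.mpr h0) (Order.one_le_iff_ne_zero.mpr hq0)
        exact (lt_add_one (1 : Ordinal.{v})).not_ge (h1.trans_eq hl)
      rw [eq_empty_of_length_eq_zero hq0, append_empty] at hpq
      exact ⟨A, List.mem_cons_self, single_mem_power_iff.mp (hpq ▸ hp)⟩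

theorem eq_empty_or_single {w : TransfiniteWord.{u, v} X} {F : Set X} (hw : w ∈ power F 2) :
    w = empty ∨ ∃ x ∈ F, w = single x := by
  have h1 : w.length ≤ 1 := by
    rw [← Order.lt_add_one_iff, one_add_one_eq_two]
    exact hw.1
  rcases eq_or_ne w.length 0 with h0 | h0
  · exact Or.inl (eq_empty_of_length_eq_zero h0)
  · right
    have h : w.length = 1 := h1.antisymm (Order.one_le_iff_ne_zero.mpr h0)
    obtain ⟨l, f⟩ := w
    obtain rfl : l = 1 := h
    refine ⟨f ⟨0, mem_Iio.mpr zero_lt_one⟩, hw.2 _, ?_⟩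
    simp only [single, ofFun, TransfiniteWord.mk.injEq, heq_eq_eq, true_and]
    funext ⟨β, hβ⟩
    obtain rfl : β = 0 := by simpa using hβ
    rfl

variable [TopologicalSpace X]

attribute [local instance] wordTopology

theorem continuous_single : Continuous (single : X → TransfiniteWord.{u, v} X) := by
  refine continuous_generateFrom_iff.mpr ?_
  rintro _ ⟨L, hL, rfl⟩
  rw [preimage_compl, isOpen_compl_iff]
  by_cases h : (product L).Nonempty
  · have : single ⁻¹' product L = ⋃ A ∈ {A | A ∈ L ∧ 1 < A.2}, A.1 := by
      ext x
      simp only [mem_preimage, single_mem_product_iff, h, true_and, mem_iUnion, mem_ofPred_eq,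
        exists_prop, and_assoc]
    rw [this]
    exact (L.finite_toSet.subset fun A hA => hA.1).isClosed_biUnion fun A hA => hL A hA.1
  · rw [not_nonempty_iff_eq_empty.mp h]
    simp

theorem isIrreducible_power_two {F : Set X} (hF : IsIrreducible F) (hFc : IsClosed F) :
    IsIrreducible (power F (2 : Ordinal.{v})) := by
  have : power F (2 : Ordinal.{v}) = closure (single '' F) := by
    refine Subset.antisymm (fun w hw => ?_) (closure_minimal ?_ (isClosed_power hFc _))
    · rcases eq_empty_or_single hw with rfl | ⟨x, hx, rfl⟩
      · obtain ⟨x, hx⟩ := hF.1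
        -- A neighbourhood of the empty word contains all its superwords, in particular one-letter
        -- words over `F`.
        by_contra h
        exact isClosed_closure.isOpen_compl.mem_of_subword (Subword.empty (single x)) h
          (subset_closure (mem_image_of_mem _ hx))
      · exact subset_closure (mem_image_of_mem _ hx)
    · rintro _ ⟨x, hx, rfl⟩
      exact single_mem_power_iff.mpr ⟨one_lt_two, hx⟩
  rw [this]
  exact (hF.image _ continuous_single.continuousOn).closure

theorem _root_.IsIrreducible.of_power_two {F : Set X} (hF : F.Nonempty)
    (h : IsIrreducible (power F (2 : Ordinal.{v}))) : IsIrreducible F := by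
  refine ⟨hF, isPreirreducible_iff_isClosed_union_isClosed.mpr fun z₁ z₂ h₁ h₂ hz => ?_⟩
  refine (isPreirreducible_iff_isClosed_union_isClosed.mp h.2 _ _ (isClosed_power h₁ 2)
    (isClosed_power h₂ 2) fun w hw => ?_).imp (fun h' x hx => ?_) fun h' x hx => ?_
  · rcases eq_empty_or_single hw with rfl | ⟨x, hx, rfl⟩
    · exact Or.inl (mem_power_iff.mpr ⟨two_pos, by simp⟩)
    · exact (hz hx).imp (fun h => single_mem_power_iff.mpr ⟨one_lt_two, h⟩)
        fun h => single_mem_power_iff.mpr ⟨one_lt_two, h⟩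
  · exact (single_mem_power_iff.mp (h' (single_mem_power_iff.mpr ⟨one_lt_two, hx⟩))).2
  · exact (single_mem_power_iff.mp (h' (single_mem_power_iff.mpr ⟨one_lt_two, hx⟩))).2

theorem omega0_opow_zero_add_one : ω ^ (0 : Ordinal.{v}) + 1 = 2 := by
  rw [opow_zero, one_add_one_eq_two]

theorem IsBound.pos {γ : Ordinal.{v}} (hγ : IsBound γ) : 0 < γ := by
  obtain ⟨β, rfl | rfl⟩ := hγ
  · exact opow_pos _ omega0_pos
  · exact (opow_pos _ omega0_pos).trans (lt_add_one _)

theorem isIrreducible_power {A : Set X × Ordinal.{v}} (hA : IsAtomExpr A) (hn : A.1.Nonempty) :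
    IsIrreducible (power A.1 A.2) := by
  by_cases h : A.2 = ω ^ (0 : Ordinal.{v}) + 1
  · have hi := isIrreducible_power_two.{u, v} (hA.isIrreducible h) hA.isClosed
    rwa [h, omega0_opow_zero_add_one]
  · refine ⟨⟨empty, mem_power_iff.mpr ⟨hA.isBound.pos, by simp⟩⟩, ?_⟩
    rintro U V hU hV ⟨a, ha, haU⟩ ⟨b, hb, hbV⟩
    obtain ⟨c, hc, hac, hbc⟩ :=
      exists_subword_subword hn (fun l hl => hA.isBound.two_mul_lt h hl) ha hb
    exact ⟨c, hc, hU.mem_of_subword hac haU, hV.mem_of_subword hbc hbV⟩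

omit [TopologicalSpace X] in
theorem power_subset_singleton_empty {F : Set X} {γ : Ordinal.{v}} (h : F = ∅ ∨ γ ≤ 1) :
    power F γ ⊆ {empty} := by
  intro w hw
  refine eq_empty_of_length_eq_zero ?_
  rcases h with rfl | h
  · by_contra h0
    exact hw.2 ⟨0, pos_iff_ne_zero.mpr h0⟩
  · simpa using hw.1.trans_le h

theorem HasAtomProducts.mono {S T : Set (TransfiniteWord.{u, v} X)} (hT : HasAtomProducts T)
    (h : S ⊆ T) : HasAtomProducts S :=
  fun C hC => hT C (hC.trans h)

theorem hasAtomProducts_power [NoetherianSpace X] (F : Set X) (hF : IsClosed F)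
    (γ : Ordinal.{v}) : HasAtomProducts (power F γ) := by
  refine power_inter_product_induction (fun _ _ hst ht => ht.mono hst)
    (fun L hLc hL => hasAtomProducts_product (L := L) hLc hL) (fun F γ hF hlt hinter => ?_) F hF γ
  by_cases htriv : F = ∅ ∨ γ ≤ 1
  · exact hasAtomProducts_singleton.mono (power_subset_singleton_empty htriv)
  obtain ⟨hne, h1⟩ := not_or.mp htriv
  rw [← Ne, ← nonempty_iff_ne_empty] at hne
  rw [not_le] at h1
  by_cases hb : IsBound γ
  · intro C hC hCi hCc
    by_cases h : power F γ ⊆ C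
    · obtain rfl := h.antisymm hC
      refine ⟨[(F, γ)], ?_, (product_singleton (F, γ)).symm⟩
      simp only [List.mem_singleton, forall_eq]
      refine ⟨⟨hF, hb, ?_, fun h2 => ?_⟩, hne⟩
      · simpa using h1.ne'
      · rw [show γ = 2 from h2.trans omega0_opow_zero_add_one] at hCi
        exact IsIrreducible.of_power_two hne hCi
    · obtain ⟨w, hw, hwC⟩ := not_subset.mp h
      obtain ⟨_, ⟨L, hL, rfl⟩, hwL, hCL⟩ := hCi.exists_subset_compl_of_notMem rfl hCc hwC
      rw [compl_compl] at hCL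
      exact hinter L hL (fun h => hwL (h hw)) C (subset_inter hC hCL) hCi hCc
  · obtain ⟨c, d, hc, hd, hcd⟩ := exists_le_add_of_not_isBound (zero_lt_one.trans h1).ne' hb
    exact ((hlt _ hc).concat (hlt _ hd) (isClosed_power hF _) (isClosed_power hF _)).mono
      (power_subset_concat ((lt_add_one c).trans hc) hcd)

/-! ### Products of atoms versus α-products. -/

theorem IsAlphaProduct.isClosed {α : Ordinal.{v}} {C : Set (TransfiniteWord.{u, v} X)}
    (h : IsAlphaProduct α C) : IsClosed C := by
  obtain ⟨L, hL, -, rfl⟩ := h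
  exact isClosed_product fun A hA => (hL A hA).1.isClosed

theorem IsAlphaProduct.isIrreducible {α : Ordinal.{v}} {C : Set (TransfiniteWord.{u, v} X)}
    (h : IsAlphaProduct α C) : IsIrreducible C := by
  obtain ⟨L, hL, -, rfl⟩ := h
  exact isIrreducible_product fun A hA => isIrreducible_power (hL A hA).1 (hL A hA).2.1

omit [TopologicalSpace X] in
theorem product_subset_below_opow {β : Ordinal.{v}} {L : List (Set X × Ordinal.{v})}
    (hL : ∀ A ∈ L, A.2 ≤ ω ^ β) : product L ⊆ below X (ω ^ β) := by
  induction L with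
  | nil =>
    rintro _ rfl
    exact opow_pos _ omega0_pos
  | cons A L ih =>
    rw [List.forall_mem_cons] at hL
    rintro _ ⟨p, hp, q, hq, rfl⟩
    exact isPrincipal_add_omega0_opow β (hp.1.trans_le hL.1) (ih hL.2 hq)

theorem IsAlphaProduct.subset_below {α : Ordinal.{v}} (hα : IsBound α)
    {C : Set (TransfiniteWord.{u, v} X)} (h : IsAlphaProduct α C) : C ⊆ below X α := by
  obtain ⟨L, hL, hlast, rfl⟩ := h
  obtain ⟨β, rfl | rfl⟩ := hα
  · exact product_subset_below_opow fun A hA => (hL A hA).2.2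
  · have hlast := hlast (not_isIndecomposable_omega0_opow_add_one β)
    rcases L.eq_nil_or_concat' with rfl | ⟨M, A, rfl⟩
    · rintro _ rfl
      exact (opow_pos _ omega0_pos).trans (lt_add_one _)
    · rw [List.dropLast_concat] at hlast
      rw [product_append, product_singleton]
      rintro _ ⟨p, hp, q, hq, rfl⟩
      have hp' : p.length < ω ^ β := product_subset_below_opow
        (fun B hB => Order.lt_add_one_iff.mp (hlast B hB)) hp
      have hq' : q.length ≤ ω ^ β :=
        Order.lt_add_one_iff.mp (hq.1.trans_le (hL A (by simp)).2.2)
      show p.length + q.length < ω ^ β + 1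
      refine Order.lt_add_one_iff.mpr ?_
      -- Everything before the last factor is shorter than ω^β and is absorbed by it.
      calc p.length + q.length ≤ p.length + ω ^ β := by gcongr
        _ = ω ^ β := (isPrincipal_add_omega0_opow β).add_eq_right hp'

theorem IsAtomExpr.one_lt {A : Set X × Ordinal.{v}} (hA : IsAtomExpr A) : 1 < A.2 := by
  refine lt_of_le_of_ne (Order.one_le_iff_pos.mpr hA.isBound.pos) fun h => hA.nontrivial ?_
  rw [← h, opow_zero]

/-- A violated constraint yields a word that is too long: a constant word of length α, or one of
length ω^β followed by a letter from the last factor. -/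
theorem IsAtomProduct.isAlphaProduct {α : Ordinal.{v}} (hα : IsBound α)
    {C : Set (TransfiniteWord.{u, v} X)} (hC : IsAtomProduct C) (h : C ⊆ below X α) :
    IsAlphaProduct α C := by
  obtain ⟨L, hL, rfl⟩ := hC
  have hne : ∀ M ⊆ L, empty ∈ product M := fun M hM => by
    induction M with
    | nil => exact rfl
    | cons A M ih =>
      rw [List.cons_subset] at hM
      exact ⟨empty, mem_power_iff.mpr ⟨(hL A hM.1).1.isBound.pos, by simp⟩, empty, ih hM.2,
        empty_append⟩
  refine ⟨L, fun A hA => ⟨(hL A hA).1, (hL A hA).2, ?_⟩, fun hi A hA => ?_, rfl⟩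
  · by_contra hlt
    obtain ⟨x, hx⟩ := (hL A hA).2
    have hw : ofFun α (fun _ => x) ∈ power A.1 A.2 := ofFun_mem_power (not_le.mp hlt) fun _ _ => hx
    exact lt_irrefl α (h (power_subset_product ⟨_, hne L (List.Subset.refl L)⟩ hA hw))
  · obtain ⟨β, rfl | rfl⟩ := hα
    · exact absurd ⟨β, rfl⟩ hi
    by_contra hlt
    rw [not_lt] at hlt
    rcases L.eq_nil_or_concat' with rfl | ⟨M, B, rfl⟩
    · simp at hA
    rw [List.dropLast_concat] at hA
    obtain ⟨x, hx⟩ := (hL A (by simp [hA])).2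
    obtain ⟨y, hy⟩ := (hL B (by simp)).2
    have hw : ofFun (ω ^ β) (fun _ => x) ∈ product M :=
      power_subset_product ⟨_, hne M (List.subset_append_left _ _)⟩ hA
        (ofFun_mem_power ((lt_add_one _).trans_le hlt) fun _ _ => hx)
    have hwy : append (ofFun (ω ^ β) fun _ => x) (single y) ∈ product (M ++ [B]) := by
      rw [product_append, product_singleton]
      exact ⟨_, hw, _, single_mem_power_iff.mpr ⟨(hL B (by simp)).1.one_lt, hy⟩, rfl⟩
    exact lt_irrefl (ω ^ β + 1) (h hwy)

theorem isIrreducible_and_isClosed_iff_isAlphaProduct [NoetherianSpace X] {α : Ordinal.{v}}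
    (hα : IsBound α) {C : Set (TransfiniteWord.{u, v} X)} :
    C ⊆ below X α ∧ IsIrreducible C ∧ IsClosed C ↔ IsAlphaProduct α C := by
  refine ⟨fun ⟨h, hi, hc⟩ => IsAtomProduct.isAlphaProduct hα ?_ h,
    fun h => ⟨h.subset_below hα, h.isIrreducible, h.isClosed⟩⟩
  exact hasAtomProducts_power univ isClosed_univ α C (fun w hw => ⟨h hw, fun _ => trivial⟩) hi hc

/-! ### Transfer to subspaces. -/

theorem isClosed_below (α : Ordinal.{v}) : IsClosed (below X α) := by
  convert isClosed_power (isClosed_univ (X := X)) α using 1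
  ext w
  simp [below, power]

theorem noetherianSpace_words [NoetherianSpace X] (Y : Set (TransfiniteWord.{u, v} X)) :
    NoetherianSpace Y :=
  Topology.IsInducing.noetherianSpace (i := Subtype.val)
    ⟨regularSubwordTopology_eq_induced Y⟩

theorem exists_isIrreducible_isClosed_image_eq_iff (α : Ordinal.{v})
    (C : Set (TransfiniteWord.{u, v} X)) :
    (∃ D : Set (below X α), IsIrreducible D ∧ IsClosed D ∧ Subtype.val '' D = C) ↔
      C ⊆ below X α ∧ IsIrreducible C ∧ IsClosed C := by
  have hind : Topology.IsInducing (Subtype.val : below X α → TransfiniteWord.{u, v} X) :=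
    ⟨regularSubwordTopology_eq_induced _⟩
  constructor
  · rintro ⟨D, hi, hc, rfl⟩
    obtain ⟨E, hE, rfl⟩ := hind.isClosed_iff.mp hc
    refine ⟨Subtype.coe_image_subset _ _, hi.image _ hind.continuous.continuousOn, ?_⟩
    rw [Subtype.image_preimage_coe]
    exact (isClosed_below α).inter hE
  · rintro ⟨h, hi, hc⟩
    have himg : Subtype.val '' (Subtype.val ⁻¹' C : Set (below X α)) = C := by
      rwa [Subtype.image_preimage_coe, inter_eq_right]
    refine ⟨Subtype.val ⁻¹' C, ⟨?_, ?_⟩, hc.preimage hind.continuous, himg⟩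
    · rw [← image_nonempty (f := Subtype.val), himg]
      exact hi.1
    · rintro U V hU hV ⟨x, hx, hxU⟩ ⟨y, hy, hyV⟩
      obtain ⟨U, hU', rfl⟩ := hind.isOpen_iff.mp hU
      obtain ⟨V, hV', rfl⟩ := hind.isOpen_iff.mp hV
      obtain ⟨z, hz, hzUV⟩ := hi.2 U V hU' hV' ⟨x, hx, hxU⟩ ⟨y, hy, hyV⟩
      exact ⟨⟨z, h hz⟩, hz, hzUV⟩

end Atoms

end TransfiniteWord

theorem mainTheorem1 {X : Type u} [TopologicalSpace X] [TopologicalSpace.NoetherianSpace X] :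
    (∀ Y : Set (TransfiniteWord.{u, v} X), TopologicalSpace.NoetherianSpace Y) ∧
    (∀ α : Ordinal.{v}, TransfiniteWord.IsBound α →
      ∀ C : Set (TransfiniteWord.{u, v} X),
        (∃ D : Set (TransfiniteWord.below X α),
          IsIrreducible D ∧ IsClosed D ∧ Subtype.val '' D = C) ↔
        TransfiniteWord.IsAlphaProduct α C) :=
  ⟨TransfiniteWord.noetherianSpace_words, fun α hα C =>
    (TransfiniteWord.exists_isIrreducible_isClosed_image_eq_iff α C).trans
      (TransfiniteWord.isIrreducible_and_isClosed_iff_isAlphaProduct hα)⟩
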